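/- Let $0<b\le 1$. The $(1,[0,b])$-model is the Markov chain on $[0,1)$ given by \[ \eta(t+1)=\begin{cases}\eta(t)+U_{t+1} & \text{if } \eta(t)+U_{t+1}<1,\\ 0 & \text{if } \eta(t)+U_{t+1}\ge 1,\end{cases} \] where $U_1,U_2,\dots$ are i.i.d. uniform on $[0,b]$ and $U_{t+1}$ is independent of $\eta(0),\dots,\eta(t)$ (one site; energy is added, and the site becomes empty when its energy reaches the threshold $1$). (a) For every $b\in(0,1]$ this chain has exactly one stationary distribution $\rho^b$. Its distribution function $F^b(h)=\rho^b(\{\eta: 0\le\eta\le h\})$, $h\in\mathbb{R}$, satisfies $F^b(h)=0$ for $h<0$, $F^b(0)>0$, $F^b(h)=1$ for $h>1$, and \[ F^b(h)=F^b(0)\sum_{\kappa=0}^{\lceil h/b\rceil-1}\frac{(-1)^\kappa}{b^\kappa\,\kappa!}(h-\kappa b)^\kappa e^{(h-\kappa b)/b}\qquad\text{for } 0<h\le 1 . \] Moreover $F^b(1)=1$, so that \[ F^b(0)=\left(\sum_{\kappa=0}^{\lceil 1/b\rceil-1}\frac{(-1)^\kappa}{b^\kappa\,\kappa!}(1-\kappa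 b)^\kappa e^{(1-\kappa b)/b}\right)^{-1}. \] (b) For every $h\in[0,1]$, $\lim_{b\downarrow 0}F^b(h)=h$. -/

import Mathlib

open MeasureTheory ProbabilityTheory Filter Topology

namespace Zhang

/-- The state space of the model on one site: stable energies, i.e. elements of `[0, 1)`. -/
abbrev State : Type := Set.Ico (0 : ℝ) 1

/-- The empty (zero energy) state. -/
def State.empty : State := ⟨0, le_refl 0, zero_lt_one⟩

/-- The result of adding the amount of energy `u` to the state `η` and stabilizing. If the new
energy is below the threshold `1`, it is the new state. If it is at least `1`, the site topples: the
left half and the right half of its energy both leave the system, so the site becomes empty.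
(Additions are nonnegative, so the energy `η + u` is never negative; the requirement `0 ≤ η + u`
only serves to make the function total in `u : ℝ`.) -/
noncomputable def addStabilize (u : ℝ) (η : State) : State :=
  open Classical in
  if h : 0 ≤ (η : ℝ) + u ∧ (η : ℝ) + u < 1 then ⟨(η : ℝ) + u, h.1, h.2⟩ else State.empty

theorem measurable_addStabilize :
    Measurable (fun p : State × ℝ => addStabilize p.2 p.1) := by
  have hm : Measurable (fun p : State × ℝ => (p.1 : ℝ) + p.2) :=
    (measurable_subtype_coe.comp measurable_fst).add measurable_snd
  refine Measurable.subtype_mk (p := fun x : ℝ => x ∈ Set.Ico (0 : ℝ) 1)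
    (f := fun p : State × ℝ => ((addStabilize p.2 p.1 : State) : ℝ))
    (h := fun p => (addStabilize p.2 p.1).2) ?_
  have he : (fun p : State × ℝ => ((addStabilize p.2 p.1 : State) : ℝ)) =
      fun p => (Set.Ico (0 : ℝ) 1).indicator (fun x => x) ((p.1 : ℝ) + p.2) := by
    classical
    funext p
    by_cases h : 0 ≤ (p.1 : ℝ) + p.2 ∧ (p.1 : ℝ) + p.2 < 1
    · rw [Set.indicator_of_mem (show _ ∈ Set.Ico (0 : ℝ) 1 from h)]
      simp [addStabilize, h]
    · rw [Set.indicator_of_notMem (show _ ∉ Set.Ico (0 : ℝ) 1 from h)]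
      simp only [addStabilize, dif_neg h, State.empty]
  rw [he]
  exact (measurable_id.indicator measurableSet_Ico).comp hm

/-- The uniform distribution on the interval `[a, b]` (for `a < b`). -/
noncomputable def uniformLaw (a b : ℝ) : Measure ℝ := volume[|Set.Icc a b]

/-- The transition kernel of the `(1, [a, b])`-model: from the state `η`, the next state is
`addStabilize U η`, where `U` is uniformly distributed on `[a, b]`. -/
noncomputable def transition (a b : ℝ) : Kernel State State where
  toFun η := (uniformLaw a b).map (fun u => addStabilize u η)
  measurable' := by
    have : SFinite (uniformLaw a b) := by unfold uniformLaw; infer_instance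
    have h1 : Measurable (fun η : State => (uniformLaw a b).map (Prod.mk η)) :=
      Measurable.map_prodMk_left
    have h2 := (Measure.measurable_map _ measurable_addStabilize).comp h1
    convert h2 using 2 with η
    simp only [Function.comp]
    rw [Measure.map_map measurable_addStabilize measurable_prodMk_left]
    rfl

/-- `ρ` is a stationary distribution of the `(1, [a, b])`-model. -/
def IsStationary (a b : ℝ) (ρ : Measure State) : Prop :=
  IsProbabilityMeasure ρ ∧ (transition a b).Invariant ρ

/-- The distribution function of the energy under `ρ`, namely `h ↦ ρ (η : 0 ≤ η ≤ h)`. -/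
noncomputable def distFun (ρ : Measure State) (h : ℝ) : ℝ :=
  ρ.real {η : State | 0 ≤ (η : ℝ) ∧ (η : ℝ) ≤ h}

/-- The sum `∑_{κ = 0}^{⌈h/b⌉ - 1} (-1)^κ / (b^κ κ!) * (h - κ b)^κ * e^{(h - κ b)/b}`, for
`0 < b` and `0 < h`; its summation range is `0 ≤ κ < ⌈h/b⌉`. -/
noncomputable def delaySum (b h : ℝ) : ℝ :=
  ∑ κ ∈ Finset.range ⌈h / b⌉₊,
    (-1 : ℝ) ^ κ / (b ^ κ * (Nat.factorial κ : ℝ)) * (h - (κ : ℝ) * b) ^ κ *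
      Real.exp ((h - (κ : ℝ) * b) / b)

end Zhang

/-!
In units of `b`, the distribution function `G x = F (b * x)` of a stationary distribution satisfies
the renewal equation `G x = G 0 + ∫ s in (x - 1)..x, G s` on `[0, 1 / b]`, and it vanishes for
`x < 0`: after one step the energy is at most `h` exactly if the site has toppled or the increased energy is
still at most `h`, and the probability of toppling is the mass of the empty state
(`Zhang.IsStationary.distFun_eq`).

A comparison principle for such equations, `Zhang.nonneg_of_integral_le`, gives everything else.

* The explicit sum `D` solves the renewal equation with constant term `1`
  (`Zhang.renewalSum_eq`), so `G = G 0 * D` by comparison in both directions. As `G (1 / b) = 1`, this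
  determines `G 0`, and with it the stationary distribution.
* The increments `D x - D (x - 1)` are nonnegative, again by comparison, and `D` is one plus their
  integral. They are therefore, up to a factor, the density away from the empty state of a
  probability measure, and the renewal equation for `D` says that this measure is stationary
  (`Zhang.exists_isStationary`).
* The affine functions `2 * x + c` solve the renewal equation with constant term `1`. Comparison with
  `c = 0` and `c = 2` gives `G 0 * 2 * x ≤ G x ≤ G 0 * (2 * x + 2)`. At `x = 1 / b` this yields
  `2 * G 0 / b → 1`, and hence `|F h - h| ≤ b` (`Zhang.IsStationary.abs_distFun_sub_le`).
-/

namespace Zhang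

/-! ### A comparison principle for the delay integral inequality -/

/-- A nonnegative function dominated by its own integral vanishes: iterating the bound gives
`φ t ≤ M * t ^ n / n!` for all `n`. -/
theorem eq_zero_of_le_integral {φ : ℝ → ℝ} {T : ℝ}
    (hφ : ∀ a c, IntervalIntegrable φ volume a c) (h0 : ∀ t, 0 ≤ φ t)
    (h : ∀ t, 0 ≤ t → t ≤ T → φ t ≤ ∫ s in (0 : ℝ)..t, φ s) :
    ∀ t, 0 ≤ t → t ≤ T → φ t = 0 := by
  set M := ∫ s in (0 : ℝ)..T, φ s with hM
  have key : ∀ n : ℕ, ∀ t, 0 ≤ t → t ≤ T → φ t ≤ M * (t ^ n / (Nat.factorial n : ℝ)) := by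
    intro n
    induction n with
    | zero =>
      intro t ht htT
      refine (h t ht htT).trans ?_
      simp only [pow_zero, Nat.factorial_zero, Nat.cast_one, div_one, mul_one]
      rw [hM, ← intervalIntegral.integral_add_adjacent_intervals (hφ 0 t) (hφ t T)]
      have := intervalIntegral.integral_nonneg (μ := volume) htT (fun u _ => h0 u)
      linarith
    | succ n ih =>
      intro t ht htT
      refine (h t ht htT).trans ?_
      have hmono : ∫ s in (0 : ℝ)..t, φ s ≤
          ∫ s in (0 : ℝ)..t, M * (s ^ n / (Nat.factorial n : ℝ)) := by
        refine intervalIntegral.integral_mono_on ht (hφ 0 t) ?_ ?_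
        · exact Continuous.intervalIntegrable (by fun_prop) _ _
        · intro s hs
          exact ih s hs.1 (hs.2.trans htT)
      refine hmono.trans (le_of_eq ?_)
      rw [intervalIntegral.integral_const_mul, intervalIntegral.integral_div, integral_pow,
        Nat.factorial_succ]
      push_cast
      have h1 : (n : ℝ) + 1 ≠ 0 := by positivity
      have h2 : (Nat.factorial n : ℝ) ≠ 0 := by positivity
      field_simp
      simp
  intro t ht htT
  refine le_antisymm ?_ (h0 t)
  have hlim := (FloorSemiring.tendsto_pow_div_factorial_atTop t).const_mul M
  rw [mul_zero] at hlim
  exact ge_of_tendsto' hlim (fun n => key n t ht htT)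

/-- Comparison principle: a supersolution of the averaging equation `f t = ∫ s in (t - 1)..t, f s` on
`[0, T]` that is nonnegative on `[-1, 0)` is nonnegative. Its negative part is dominated by its own
integral from `0`. -/
theorem nonneg_of_integral_le {f : ℝ → ℝ} {T : ℝ}
    (hf : ∀ a c, IntervalIntegrable f volume a c) (h0 : ∀ t, -1 ≤ t → t < 0 → 0 ≤ f t)
    (h : ∀ t, 0 ≤ t → t ≤ T → ∫ s in (t - 1)..t, f s ≤ f t) :
    ∀ t, 0 ≤ t → t ≤ T → 0 ≤ f t := by
  set φ : ℝ → ℝ := fun t => max (-f t) 0 with hφdef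
  have hφ : ∀ a c, IntervalIntegrable φ volume a c := by
    intro a c
    have : φ = fun t => (|f t| - f t) / 2 := by
      funext t
      simp only [hφdef]
      rcases le_total 0 (f t) with h | h
      · rw [max_eq_right (by linarith), abs_of_nonneg h]; ring
      · rw [max_eq_left (by linarith), abs_of_nonpos h]; ring
    rw [this]
    exact ((hf a c).abs.sub (hf a c)).div_const 2
  have hφ0 : ∀ t, 0 ≤ φ t := fun t => le_max_right _ _
  have hneg : ∀ t, -1 ≤ t → t < 0 → φ t = 0 := fun t h1 h2 =>
    max_eq_right (by linarith [h0 t h1 h2])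
  intro t ht htT
  have hz := eq_zero_of_le_integral (T := T) hφ hφ0 (fun t ht htT => ?_) t ht htT
  · have := le_max_left (-f t) 0
    change -f t ≤ φ t at this
    linarith
  have hint0 : ∀ c, -1 ≤ c → c ≤ 0 → ∫ s in c..0, φ s = 0 := by
    intro c hc hc0
    rw [intervalIntegral.integral_of_le hc0, integral_Ioc_eq_integral_Ioo]
    exact setIntegral_eq_zero_of_forall_eq_zero fun s hs => hneg s (by linarith [hs.1]) hs.2
  have hle : ∫ s in (t - 1)..t, φ s ≤ ∫ s in (0 : ℝ)..t, φ s := by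
    rw [← intervalIntegral.integral_add_adjacent_intervals (hφ (t - 1) 0) (hφ 0 t)]
    rcases le_total (t - 1) 0 with h1 | h1
    · rw [hint0 _ (by linarith) h1, zero_add]
    · have := intervalIntegral.integral_nonneg (μ := volume) h1 (fun u _ => hφ0 u)
      rw [intervalIntegral.integral_symm 0 (t - 1)]
      linarith
  refine le_trans ?_ hle
  refine max_le ?_ (intervalIntegral.integral_nonneg (by linarith) (fun u _ => hφ0 u))
  have h1 : ∫ s in (t - 1)..t, -f s ≤ ∫ s in (t - 1)..t, φ s :=
    intervalIntegral.integral_mono_on (by linarith) (hf _ _).neg (hφ _ _)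
      (fun s _ => le_max_left _ _)
  rw [intervalIntegral.integral_neg] at h1
  linarith [h t ht htT]

/-! ### The explicit solution of the delay equation -/

/-- The function `(-y)^κ / κ! * e^y`. -/
noncomputable def delayPoly (κ : ℕ) (y : ℝ) : ℝ :=
  (-y) ^ κ / (Nat.factorial κ : ℝ) * Real.exp y

/-- The function `(κ - x)^κ / κ! * e^(x - κ)` for `x ≥ κ`, and zero for `x < κ`: the summand of
index `κ` of the explicit solution in units of `b`. It is continuous except for `κ = 0`, which has
the value `1` at the jump `x = 0`. -/
noncomputable def renewalTerm (κ : ℕ) (x : ℝ) : ℝ :=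
  (Set.Ici (κ : ℝ)).indicator (fun s => delayPoly κ (s - κ)) x

/-- The sum of the first `N` terms `renewalTerm κ`. For `x < N` it does not depend on `N` and is the
renewal function at `x` of the uniform distribution on `[0, 1]`, the expected number of `n ≥ 0` with
`U_1 + ⋯ + U_n ≤ x`. -/
noncomputable def renewalSum (N : ℕ) (x : ℝ) : ℝ := ∑ κ ∈ Finset.range N, renewalTerm κ x

theorem continuous_delayPoly (κ : ℕ) : Continuous (delayPoly κ) := by
  unfold delayPoly
  fun_prop

theorem hasDerivAt_delayPoly_succ (κ : ℕ) (y : ℝ) :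
    HasDerivAt (delayPoly (κ + 1)) (delayPoly (κ + 1) y - delayPoly κ y) y := by
  have h1 := (((hasDerivAt_id y).neg.pow (κ + 1)).div_const
    (Nat.factorial (κ + 1) : ℝ)).mul (Real.hasDerivAt_exp y)
  refine h1.congr_deriv ?_
  simp only [delayPoly, Nat.factorial_succ, Pi.neg_apply, Pi.pow_apply, id]
  push_cast
  have h1 : (κ : ℝ) + 1 ≠ 0 := by positivity
  have h2 : (Nat.factorial κ : ℝ) ≠ 0 := by positivity
  field_simp
  ring

theorem integral_delayPoly_zero (x : ℝ) : ∫ y in (0 : ℝ)..x, delayPoly 0 y = delayPoly 0 x - 1 := by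
  simp [delayPoly]

theorem integral_delayPoly_succ (κ : ℕ) (x : ℝ) :
    ∫ y in (0 : ℝ)..x, delayPoly (κ + 1) y =
      (∫ y in (0 : ℝ)..x, delayPoly κ y) + delayPoly (κ + 1) x := by
  have h := intervalIntegral.integral_eq_sub_of_hasDerivAt (a := 0) (b := x)
    (fun y _ => hasDerivAt_delayPoly_succ κ y)
    (((continuous_delayPoly _).sub (continuous_delayPoly _)).intervalIntegrable _ _)
  rw [intervalIntegral.integral_sub ((continuous_delayPoly _).intervalIntegrable _ _)
    ((continuous_delayPoly _).intervalIntegrable _ _)] at h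
  have h0 : delayPoly (κ + 1) 0 = 0 := by simp [delayPoly]
  linarith

theorem intervalIntegrable_renewalTerm (κ : ℕ) (a c : ℝ) :
    IntervalIntegrable (renewalTerm κ) volume a c := by
  have hc : Continuous (fun s => delayPoly κ (s - κ)) :=
    (continuous_delayPoly κ).comp (by fun_prop)
  rw [intervalIntegrable_iff]
  exact ((intervalIntegrable_iff.1 (hc.intervalIntegrable a c))).indicator measurableSet_Ici

theorem intervalIntegrable_renewalSum (N : ℕ) (a c : ℝ) :
    IntervalIntegrable (renewalSum N) volume a c := by
  have : renewalSum N = ∑ κ ∈ Finset.range N, renewalTerm κ := by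
    funext x; simp [renewalSum]
  rw [this]
  exact IntervalIntegrable.sum _ fun κ _ => intervalIntegrable_renewalTerm κ a c

theorem intervalIntegrable_renewalSum_sub_one (N : ℕ) (a c : ℝ) :
    IntervalIntegrable (fun x => renewalSum N (x - 1)) volume a c := by
  have := (intervalIntegrable_renewalSum N (a - 1) (c - 1)).comp_sub_right 1
  simpa using this

theorem renewalTerm_of_lt {κ : ℕ} {x : ℝ} (h : x < κ) : renewalTerm κ x = 0 :=
  Set.indicator_of_notMem (by simpa using h) _

theorem renewalTerm_of_le {κ : ℕ} {x : ℝ} (h : (κ : ℝ) ≤ x) :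
    renewalTerm κ x = delayPoly κ (x - κ) :=
  Set.indicator_of_mem (by simpa using h) _

theorem renewalSum_of_neg (N : ℕ) {x : ℝ} (h : x < 0) : renewalSum N x = 0 :=
  Finset.sum_eq_zero fun κ _ => renewalTerm_of_lt (h.trans_le κ.cast_nonneg)

theorem integral_renewalTerm_of_lt {κ : ℕ} {x : ℝ} (hx : -1 ≤ x) (h : x < κ) :
    ∫ s in (-1 : ℝ)..x, renewalTerm κ s = 0 := by
  rw [intervalIntegral.integral_of_le hx]
  exact setIntegral_eq_zero_of_forall_eq_zero fun s hs => renewalTerm_of_lt (hs.2.trans_lt h)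

theorem integral_renewalTerm_of_le {κ : ℕ} {x : ℝ} (h : (κ : ℝ) ≤ x) :
    ∫ s in (-1 : ℝ)..x, renewalTerm κ s = ∫ y in (0 : ℝ)..(x - κ), delayPoly κ y := by
  have hκ : (0 : ℝ) ≤ κ := κ.cast_nonneg
  have hset : Set.Ioc (-1 : ℝ) x ∩ Set.Ici (κ : ℝ) = Set.Icc (κ : ℝ) x := by
    ext s
    simp only [Set.mem_inter_iff, Set.mem_Ioc, Set.mem_Ici, Set.mem_Icc]
    constructor
    · rintro ⟨⟨_, h2⟩, h3⟩
      exact ⟨h3, h2⟩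
    · rintro ⟨h1, h2⟩
      exact ⟨⟨by linarith, h2⟩, h1⟩
  rw [intervalIntegral.integral_of_le (by linarith)]
  unfold renewalTerm
  rw [setIntegral_indicator measurableSet_Ici, hset, integral_Icc_eq_integral_Ioc,
    ← intervalIntegral.integral_of_le h,
    intervalIntegral.integral_comp_sub_right (delayPoly κ), sub_self]

theorem integral_renewalTerm_zero {x : ℝ} (hx : 0 ≤ x) :
    ∫ s in (-1 : ℝ)..x, renewalTerm 0 s = renewalTerm 0 x - 1 := by
  rw [integral_renewalTerm_of_le (by simpa using hx), renewalTerm_of_le (by simpa using hx),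
    integral_delayPoly_zero]

/-- The integrated form of the delay relation `e_{κ+1}' (x) = e_{κ+1} x - e_κ (x - 1)` between
consecutive terms. The base point `-1` lies below the supports of all terms and below `x - 1`. -/
theorem integral_renewalTerm_succ (κ : ℕ) {x : ℝ} (hx : 0 ≤ x) :
    ∫ s in (-1 : ℝ)..x, renewalTerm (κ + 1) s =
      (∫ s in (-1 : ℝ)..(x - 1), renewalTerm κ s) + renewalTerm (κ + 1) x := by
  rcases lt_or_ge x ((κ + 1 : ℕ) : ℝ) with h | h
  · rw [integral_renewalTerm_of_lt (by linarith) h, renewalTerm_of_lt h,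
      integral_renewalTerm_of_lt (by linarith) (by push_cast at h; linarith), zero_add]
  · have h' : (κ : ℝ) ≤ x - 1 := by push_cast at h; linarith
    rw [integral_renewalTerm_of_le h, renewalTerm_of_le h, integral_renewalTerm_of_le h',
      integral_delayPoly_succ]
    have : x - ((κ + 1 : ℕ) : ℝ) = x - 1 - κ := by push_cast; ring
    rw [this]

/-- The renewal equation, obtained by telescoping the relations between consecutive terms. -/
theorem renewalSum_eq {N : ℕ} {x : ℝ} (hx : 0 ≤ x) (hxN : x < N) :
    renewalSum N x = 1 + ∫ s in (x - 1)..x, renewalSum N s := by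
  obtain ⟨M, rfl⟩ : ∃ M, N = M + 1 :=
    Nat.exists_eq_succ_of_ne_zero (by rintro rfl; simp at hxN; linarith)
  have hint : ∀ c, ∫ s in (-1 : ℝ)..c, renewalSum (M + 1) s =
      ∑ κ ∈ Finset.range (M + 1), ∫ s in (-1 : ℝ)..c, renewalTerm κ s := fun c =>
    intervalIntegral.integral_finsetSum fun κ _ => intervalIntegrable_renewalTerm κ _ _
  rw [← intervalIntegral.integral_interval_sub_left
    (intervalIntegrable_renewalSum _ (-1) x) (intervalIntegrable_renewalSum _ (-1) (x - 1)),
    hint, hint, Finset.sum_range_succ', Finset.sum_range_succ (n := M), integral_renewalTerm_zero hx,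
    integral_renewalTerm_of_lt (κ := M) (by linarith) (by push_cast at hxN; linarith)]
  simp only [integral_renewalTerm_succ _ hx, Finset.sum_add_distrib]
  rw [renewalSum, Finset.sum_range_succ']
  ring

/-- The increments over unit length are nonnegative. They vanish on `[-1, 0)` and satisfy the averaging
equation from time `1` on; on `[0, 1)` the constant term of the renewal equation makes them a
supersolution. -/
theorem renewalSum_sub_one_nonneg {N : ℕ} {T : ℝ} (hT : T < N) :
    ∀ x, 0 ≤ x → x ≤ T → 0 ≤ renewalSum N x - renewalSum N (x - 1) := by
  have hshift := intervalIntegrable_renewalSum_sub_one N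
  refine nonneg_of_integral_le
    (fun a c => (intervalIntegrable_renewalSum N a c).sub (hshift a c)) ?_ ?_
  · intro t _ ht
    rw [renewalSum_of_neg N ht, renewalSum_of_neg N (by linarith), sub_zero]
  · intro t ht htT
    rw [intervalIntegral.integral_sub (intervalIntegrable_renewalSum N _ _) (hshift _ _),
      intervalIntegral.integral_comp_sub_right (renewalSum N)]
    have h1 := renewalSum_eq ht (htT.trans_lt hT)
    rcases lt_or_ge t 1 with h | h
    · have h2 : ∫ s in (t - 1 - 1)..(t - 1), renewalSum N s = 0 := by
        rw [intervalIntegral.integral_of_le (by linarith)]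
        exact setIntegral_eq_zero_of_forall_eq_zero fun s hs =>
          renewalSum_of_neg N (by linarith [hs.2])
      rw [h2, renewalSum_of_neg N (by linarith : t - 1 < 0)]
      linarith
    · have h2 := renewalSum_eq (N := N) (x := t - 1) (by linarith) (by linarith)
      linarith

/-- The renewal function is one plus the integral of its increments over unit length; this exhibits
the density of the stationary distribution. -/
theorem renewalSum_eq_integral {N : ℕ} {x : ℝ} (hx : 0 ≤ x) (hxN : x < N) :
    renewalSum N x = 1 + ∫ s in (0 : ℝ)..x, (renewalSum N s - renewalSum N (s - 1)) := by
  have hshift := intervalIntegrable_renewalSum_sub_one N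
  have hI := fun a c => intervalIntegrable_renewalSum N a c
  have h0 : ∫ s in (-1 : ℝ)..0, renewalSum N s = 0 := by
    rw [intervalIntegral.integral_of_le (by norm_num), integral_Ioc_eq_integral_Ioo]
    exact setIntegral_eq_zero_of_forall_eq_zero fun s hs => renewalSum_of_neg N hs.2
  rw [intervalIntegral.integral_sub (hI _ _) (hshift _ _),
    intervalIntegral.integral_comp_sub_right (renewalSum N), renewalSum_eq hx hxN, zero_sub,
    ← intervalIntegral.integral_add_adjacent_intervals (hI (-1) 0) (hI 0 (x - 1)), h0,
    ← intervalIntegral.integral_interval_sub_left (hI 0 x) (hI 0 (x - 1))]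
  ring

/-- The ranges of summation `κ < h / b` and `κ ≤ h / b` agree, as a term with `κ = h / b > 0` is
zero. -/
theorem delaySum_eq_renewalSum {b h : ℝ} {N : ℕ} (hb : 0 < b) (hh : 0 < h) (hN : h / b < N) :
    delaySum b h = renewalSum N (h / b) := by
  have hx : 0 < h / b := div_pos hh hb
  unfold delaySum renewalSum
  have hsub : Finset.range ⌈h / b⌉₊ ⊆ Finset.range N :=
    Finset.range_mono (Nat.ceil_le.2 hN.le)
  rw [← Finset.sum_subset hsub]
  · refine Finset.sum_congr rfl fun κ hκ => ?_
    have h1 : (κ : ℝ) < h / b := Nat.lt_ceil.1 (Finset.mem_range.1 hκ)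
    rw [renewalTerm_of_le h1.le, delayPoly]
    have h2 : (h - κ * b) / b = h / b - κ := by field_simp
    have h3 : h - κ * b = b * (h / b - κ) := by field_simp
    rw [h2, h3, mul_pow, neg_pow (h / b - κ)]
    have h4 : (b : ℝ) ^ κ ≠ 0 := by positivity
    field_simp
  · intro κ _ hκ
    have h1 : h / b ≤ κ := by
      by_contra hcon
      exact hκ (Finset.mem_range.2 (Nat.lt_ceil.2 (not_le.1 hcon)))
    rcases h1.lt_or_eq with h2 | h2
    · exact renewalTerm_of_lt h2
    · rw [renewalTerm_of_le h2.ge, delayPoly, h2, sub_self, neg_zero, zero_pow, zero_div, zero_mul]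
      rintro rfl
      simp at h2
      rcases h2 with h2 | h2 <;> linarith

/-! ### Distribution functions and one step of the chain -/

theorem measurableSet_distFun (h : ℝ) : MeasurableSet {η : State | 0 ≤ (η : ℝ) ∧ (η : ℝ) ≤ h} :=
  (measurableSet_le measurable_const measurable_subtype_coe).inter
    (measurableSet_le measurable_subtype_coe measurable_const)

theorem monotone_distFun (ρ : Measure State) [IsProbabilityMeasure ρ] : Monotone (distFun ρ) :=
  fun _ _ hxy => measureReal_mono fun _ hη => ⟨hη.1, hη.2.trans hxy⟩

theorem distFun_of_neg (ρ : Measure State) {h : ℝ} (hh : h < 0) : distFun ρ h = 0 := by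
  have : {η : State | 0 ≤ (η : ℝ) ∧ (η : ℝ) ≤ h} = ∅ :=
    Set.eq_empty_of_forall_notMem fun η hη => absurd (hη.1.trans hη.2) (not_le.2 hh)
  rw [distFun, this, measureReal_empty]

theorem distFun_of_one_le (ρ : Measure State) [IsProbabilityMeasure ρ] {h : ℝ} (hh : 1 ≤ h) :
    distFun ρ h = 1 := by
  have : {η : State | 0 ≤ (η : ℝ) ∧ (η : ℝ) ≤ h} = Set.univ :=
    Set.eq_univ_of_forall fun η => ⟨η.2.1, η.2.2.le.trans hh⟩
  rw [distFun, this, probReal_univ]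

/-- A probability measure on the state space is determined by its distribution function: the sets
`{η | 0 ≤ η ≤ h}` with `h ∈ [0, 1)` are the lower rays of the order on states. -/
theorem eq_of_distFun_eq {ρ₁ ρ₂ : Measure State} [IsProbabilityMeasure ρ₁]
    [IsProbabilityMeasure ρ₂] (h : ∀ x, 0 ≤ x → x ≤ 1 → distFun ρ₁ x = distFun ρ₂ x) :
    ρ₁ = ρ₂ := by
  refine Measure.ext_of_Iic _ _ fun a => ?_
  have hset : Set.Iic a = {η : State | 0 ≤ (η : ℝ) ∧ (η : ℝ) ≤ a} := by
    ext η
    exact ⟨fun hη => ⟨η.2.1, hη⟩, fun hη => hη.2⟩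
  rw [hset, ← measureReal_eq_measureReal_iff]
  exact h a a.2.1 a.2.2.le

theorem isProbabilityMeasure_uniformLaw {b : ℝ} (hb : 0 < b) :
    IsProbabilityMeasure (uniformLaw 0 b) := by
  refine cond_isProbabilityMeasure_of_finite ?_ ?_ <;> simp [hb]

theorem ae_mem_uniformLaw (b : ℝ) : ∀ᵐ u ∂uniformLaw 0 b, u ∈ Set.Icc 0 b :=
  ae_cond_mem measurableSet_Icc

theorem uniformLaw_absolutelyContinuous (b : ℝ) : uniformLaw 0 b ≪ volume :=
  cond_absolutelyContinuous

/-- The law after one step is the law of `addStabilize U η`, for independent `η ∼ ρ` and `U` uniform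
on `[0, b]`. -/
theorem bind_transition {b : ℝ} (hb : 0 < b) (ρ : Measure State) [IsProbabilityMeasure ρ] :
    ρ.bind (transition 0 b) =
      (ρ.prod (uniformLaw 0 b)).map (fun p : State × ℝ => addStabilize p.2 p.1) := by
  have := isProbabilityMeasure_uniformLaw hb
  ext s hs
  rw [Measure.bind_apply hs (Kernel.aemeasurable _), Measure.map_apply measurable_addStabilize hs,
    Measure.prod_apply (measurable_addStabilize hs)]
  refine lintegral_congr fun η => ?_
  change (uniformLaw 0 b).map (fun u => addStabilize u η) s = _
  have hη : Measurable fun u : ℝ => addStabilize u η :=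
    measurable_addStabilize.comp measurable_prodMk_left
  rw [Measure.map_apply hη hs]
  rfl

theorem prod_real_add_le {b : ℝ} (hb : 0 < b) (ρ : Measure State) [IsProbabilityMeasure ρ]
    (h : ℝ) :
    (ρ.prod (uniformLaw 0 b)).real {p : State × ℝ | (p.1 : ℝ) + p.2 ≤ h} =
      ∫ u, distFun ρ (h - u) ∂uniformLaw 0 b := by
  have := isProbabilityMeasure_uniformLaw hb
  have hm : MeasurableSet {p : State × ℝ | (p.1 : ℝ) + p.2 ≤ h} :=
    measurableSet_le ((measurable_subtype_coe.comp measurable_fst).add measurable_snd)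
      measurable_const
  have hanti : Antitone fun u => distFun ρ (h - u) := fun u v huv =>
    monotone_distFun ρ (by linarith)
  rw [integral_eq_lintegral_of_nonneg_ae (f := fun u => distFun ρ (h - u))
    (ae_of_all _ fun u => measureReal_nonneg)
    hanti.measurable.aestronglyMeasurable, measureReal_def, Measure.prod_apply_symm hm]
  congr 1
  refine lintegral_congr fun u => ?_
  rw [distFun, ofReal_measureReal]
  congr 1
  ext η
  exact ⟨fun hη => ⟨η.2.1, le_sub_iff_add_le.2 hη⟩, fun hη => le_sub_iff_add_le.1 hη.2⟩

theorem prod_add_eq_one {b : ℝ} (hb : 0 < b) (ρ : Measure State) [IsProbabilityMeasure ρ] :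
    ∀ᵐ p : State × ℝ ∂ρ.prod (uniformLaw 0 b), (p.1 : ℝ) + p.2 ≠ 1 := by
  have := isProbabilityMeasure_uniformLaw hb
  have hm : MeasurableSet {p : State × ℝ | (p.1 : ℝ) + p.2 = 1} :=
    measurableSet_eq_fun ((measurable_subtype_coe.comp measurable_fst).add measurable_snd)
      measurable_const
  rw [ae_iff]
  simp only [ne_eq, not_not]
  rw [Measure.measure_prod_null hm]
  refine ae_of_all _ fun η => uniformLaw_absolutelyContinuous b ?_
  have : Prod.mk η ⁻¹' {p : State × ℝ | (p.1 : ℝ) + p.2 = 1} = {1 - (η : ℝ)} := by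
    ext u
    simp only [Set.mem_preimage, Set.mem_ofPred_eq, Set.mem_singleton_iff]
    constructor <;> intro h <;> linarith
  rw [this, Real.volume_singleton]

theorem coe_addStabilize {u : ℝ} (hu : 0 ≤ u) (η : State) :
    ((addStabilize u η : State) : ℝ) = if (η : ℝ) + u < 1 then (η : ℝ) + u else 0 := by
  have h0 : 0 ≤ (η : ℝ) + u := add_nonneg η.2.1 hu
  by_cases h : (η : ℝ) + u < 1 <;> simp [addStabilize, h0, h, State.empty]

/-- One step of the chain, on the level of distribution functions. The new energy is at most `h`
unless `h < η + U < 1`, because a site that topples becomes empty; up to a null set the exceptional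
event is `{η + U ≤ 1} \ {η + U ≤ h}`. -/
theorem distFun_bind_transition {b : ℝ} (hb : 0 < b) (ρ : Measure State) [IsProbabilityMeasure ρ]
    {h : ℝ} (h0 : 0 ≤ h) (h1 : h ≤ 1) :
    distFun (ρ.bind (transition 0 b)) h =
      1 - (∫ u, distFun ρ (1 - u) ∂uniformLaw 0 b) + ∫ u, distFun ρ (h - u) ∂uniformLaw 0 b := by
  have := isProbabilityMeasure_uniformLaw hb
  have hm : ∀ c : ℝ, MeasurableSet {p : State × ℝ | (p.1 : ℝ) + p.2 ≤ c} := fun c =>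
    measurableSet_le ((measurable_subtype_coe.comp measurable_fst).add measurable_snd)
      measurable_const
  have hsub : {p : State × ℝ | (p.1 : ℝ) + p.2 ≤ h} ⊆ {p : State × ℝ | (p.1 : ℝ) + p.2 ≤ 1} :=
    fun p (hp : (p.1 : ℝ) + p.2 ≤ h) => hp.trans h1
  have hu : ∀ᵐ p : State × ℝ ∂ρ.prod (uniformLaw 0 b), 0 ≤ p.2 :=
    Measure.quasiMeasurePreserving_snd.ae ((ae_mem_uniformLaw b).mono fun u hu => hu.1)
  rw [← prod_real_add_le hb, ← prod_real_add_le hb, distFun, bind_transition hb,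
    map_measureReal_apply measurable_addStabilize (measurableSet_distFun h)]
  have hset : (fun p : State × ℝ => addStabilize p.2 p.1) ⁻¹'
        {η : State | 0 ≤ (η : ℝ) ∧ (η : ℝ) ≤ h} =ᵐ[ρ.prod (uniformLaw 0 b)]
      (({p : State × ℝ | (p.1 : ℝ) + p.2 ≤ 1} \
        {p : State × ℝ | (p.1 : ℝ) + p.2 ≤ h})ᶜ : Set (State × ℝ)) := by
    filter_upwards [hu, prod_add_eq_one hb ρ] with p hp hp1
    apply propext
    change (0 ≤ ((addStabilize p.2 p.1 : State) : ℝ) ∧ ((addStabilize p.2 p.1 : State) : ℝ) ≤ h) ↔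
      ¬ ((p.1 : ℝ) + p.2 ≤ 1 ∧ ¬ (p.1 : ℝ) + p.2 ≤ h)
    rw [coe_addStabilize hp]
    have hp0 : 0 ≤ (p.1 : ℝ) + p.2 := add_nonneg p.1.2.1 hp
    split_ifs with hlt
    · simp [hp0, hlt.le]
    · have : ¬ (p.1 : ℝ) + p.2 ≤ 1 := fun hle => hlt (lt_of_le_of_ne hle hp1)
      simp [this, h0]
  rw [measureReal_congr hset, probReal_compl_eq_one_sub ((hm 1).diff (hm h)),
    measureReal_sdiff hsub (hm h)]
  ring

/-- The change of variables `s = x - u / b`, which turns an average over `[0, b]` into an integral over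
a window of length one. -/
theorem integral_uniformLaw {b : ℝ} (hb : 0 < b) (F : ℝ → ℝ) (x : ℝ) :
    ∫ u, F (b * x - u) ∂uniformLaw 0 b = ∫ s in (x - 1)..x, F (b * s) := by
  rw [uniformLaw, ProbabilityTheory.cond, integral_smul_measure, integral_Icc_eq_integral_Ioc,
    ← intervalIntegral.integral_of_le hb.le, intervalIntegral.integral_comp_sub_left F,
    intervalIntegral.integral_comp_mul_left F hb.ne']
  simp only [Real.volume_Icc, sub_zero, ENNReal.toReal_inv, ENNReal.toReal_ofReal hb.le]
  congr 2
  ring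

/-! ### The stationary equation -/

theorem intervalIntegrable_distFun {b : ℝ} (hb : 0 < b) (ρ : Measure State)
    [IsProbabilityMeasure ρ] (a c : ℝ) :
    IntervalIntegrable (fun s => distFun ρ (b * s)) volume a c :=
  Monotone.intervalIntegrable fun _ _ hst =>
    monotone_distFun ρ (mul_le_mul_of_nonneg_left hst hb.le)

theorem integral_distFun_neg {b : ℝ} (hb : 0 < b) (ρ : Measure State) :
    ∫ s in (-1 : ℝ)..0, distFun ρ (b * s) = 0 := by
  rw [intervalIntegral.integral_of_le (by norm_num), integral_Ioc_eq_integral_Ioo]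
  exact setIntegral_eq_zero_of_forall_eq_zero fun s hs =>
    distFun_of_neg ρ (mul_neg_of_pos_of_neg hb hs.2)

/-- The stationary equation in units of `b`. Comparing `distFun_bind_transition` at `h` and at `0`
identifies the constant term, the probability of toppling, as the mass of the empty state. The
endpoint `x = 1 / b` is included. -/
theorem IsStationary.distFun_eq {b : ℝ} (hb : 0 < b) {ρ : Measure State}
    (hρ : IsStationary 0 b ρ) {x : ℝ} (hx0 : 0 ≤ x) (hx1 : x ≤ 1 / b) :
    distFun ρ (b * x) = distFun ρ 0 + ∫ s in (x - 1)..x, distFun ρ (b * s) := by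
  have := hρ.1
  have hinv : ρ.bind (transition 0 b) = ρ := hρ.2
  have hstep : ∀ y, 0 ≤ y → y ≤ 1 / b → distFun ρ (b * y) =
      1 - (∫ u, distFun ρ (1 - u) ∂uniformLaw 0 b) + ∫ s in (y - 1)..y, distFun ρ (b * s) := by
    intro y hy0 hy1
    rw [← integral_uniformLaw hb, ← distFun_bind_transition hb ρ (mul_nonneg hb.le hy0)
      (by rw [le_div_iff₀ hb] at hy1; linarith), hinv]
  have hzero := hstep 0 le_rfl (by positivity)
  rw [zero_sub, integral_distFun_neg hb, add_zero, mul_zero] at hzero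
  rw [hstep x hx0 hx1, hzero]

/-- The difference of the two sides solves the homogeneous equation and vanishes on the negative
half-line, so the comparison principle bounds it by zero from both sides. -/
theorem IsStationary.distFun_eq_renewalSum {b : ℝ} (hb : 0 < b) {ρ : Measure State}
    (hρ : IsStationary 0 b ρ) {N : ℕ} (hN : 1 / b < N) {x : ℝ} (hx0 : 0 ≤ x) (hx1 : x ≤ 1 / b) :
    distFun ρ (b * x) = distFun ρ 0 * renewalSum N x := by
  have := hρ.1
  have hG := intervalIntegrable_distFun hb ρ
  have hD := fun a c => (intervalIntegrable_renewalSum N a c).const_mul (distFun ρ 0)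
  have hneg : ∀ t : ℝ, t < 0 → distFun ρ (b * t) - distFun ρ 0 * renewalSum N t = 0 := by
    intro t ht
    rw [distFun_of_neg ρ (mul_neg_of_pos_of_neg hb ht), renewalSum_of_neg N ht]
    ring
  have heq : ∀ t, 0 ≤ t → t ≤ 1 / b →
      ∫ s in (t - 1)..t, (distFun ρ (b * s) - distFun ρ 0 * renewalSum N s) =
        distFun ρ (b * t) - distFun ρ 0 * renewalSum N t := by
    intro t ht0 ht1
    rw [intervalIntegral.integral_sub (hG _ _) (hD _ _), intervalIntegral.integral_const_mul,
      hρ.distFun_eq hb ht0 ht1, renewalSum_eq ht0 (ht1.trans_lt hN)]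
    ring
  have h1 := nonneg_of_integral_le (T := 1 / b) (fun a c => (hG a c).sub (hD a c))
    (fun t _ ht => (hneg t ht).ge) (fun t ht0 ht1 => (heq t ht0 ht1).le) x hx0 hx1
  have h2 := nonneg_of_integral_le (T := 1 / b) (fun a c => ((hG a c).sub (hD a c)).neg)
    (fun t _ ht => by simp only [Pi.neg_apply, hneg t ht, neg_zero, le_refl])
    (fun t ht0 ht1 => by
      simp only [Pi.neg_apply]
      rw [intervalIntegral.integral_neg, heq t ht0 ht1]) x hx0 hx1
  simp only [Pi.neg_apply] at h2
  linarith

/-- Evaluation at the threshold fixes the normalization. -/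
theorem IsStationary.distFun_zero_mul {b : ℝ} (hb : 0 < b) {ρ : Measure State}
    (hρ : IsStationary 0 b ρ) {N : ℕ} (hN : 1 / b < N) :
    distFun ρ 0 * renewalSum N (1 / b) = 1 := by
  have := hρ.1
  rw [← hρ.distFun_eq_renewalSum hb hN (by positivity) le_rfl, mul_one_div_cancel hb.ne',
    distFun_of_one_le ρ le_rfl]

theorem IsStationary.distFun_zero_pos {b : ℝ} (hb : 0 < b) {ρ : Measure State}
    (hρ : IsStationary 0 b ρ) : 0 < distFun ρ 0 := by
  obtain ⟨N, hN⟩ := exists_nat_gt (1 / b)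
  refine lt_of_le_of_ne measureReal_nonneg fun h => ?_
  have := hρ.distFun_zero_mul hb hN
  rw [← h, zero_mul] at this
  exact zero_ne_one this

theorem IsStationary.unique {b : ℝ} (hb : 0 < b) {ρ₁ ρ₂ : Measure State}
    (h₁ : IsStationary 0 b ρ₁) (h₂ : IsStationary 0 b ρ₂) : ρ₁ = ρ₂ := by
  have := h₁.1
  have := h₂.1
  obtain ⟨N, hN⟩ := exists_nat_gt (1 / b)
  have hp : distFun ρ₁ 0 = distFun ρ₂ 0 := by
    rw [eq_one_div_of_mul_eq_one_left (h₁.distFun_zero_mul hb hN),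
      eq_one_div_of_mul_eq_one_left (h₂.distFun_zero_mul hb hN)]
  refine eq_of_distFun_eq fun h h0 h1 => ?_
  have hx0 : 0 ≤ h / b := div_nonneg h0 hb.le
  have hx1 : h / b ≤ 1 / b := div_le_div_of_nonneg_right h1 hb.le
  have := h₁.distFun_eq_renewalSum hb hN hx0 hx1
  rwa [hp, ← h₂.distFun_eq_renewalSum hb hN hx0 hx1, mul_div_cancel₀ _ hb.ne'] at this

/-! ### Existence -/

/-- The measure with an atom of mass `p` at the empty state and density `w` on `(0, 1)`. It is built on
`ℝ` and transported by `x ↦ addStabilize x State.empty`, which is the identity on `[0, 1)`. -/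
theorem exists_measure_distFun {p : ℝ} (hp : 0 ≤ p) {w : ℝ → ℝ}
    (hw : IntervalIntegrable w volume 0 1) (hw0 : ∀ x, 0 ≤ x → x ≤ 1 → 0 ≤ w x)
    (hp1 : p + ∫ x in (0 : ℝ)..1, w x = 1) :
    ∃ ρ : Measure State, IsProbabilityMeasure ρ ∧
      ∀ h, 0 ≤ h → h ≤ 1 → distFun ρ h = p + ∫ x in (0 : ℝ)..h, w x := by
  have hmeas : Measurable fun x : ℝ => addStabilize x State.empty :=
    measurable_addStabilize.comp measurable_prodMk_left
  have hcoe : ∀ x : ℝ, 0 ≤ x → x < 1 → ((addStabilize x State.empty : State) : ℝ) = x := by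
    intro x h0 h1
    rw [coe_addStabilize h0]
    simp [State.empty, h1]
  set ν : Measure ℝ := ENNReal.ofReal p • Measure.dirac 0 +
    (volume.restrict (Set.Ioo 0 1)).withDensity (fun x => ENNReal.ofReal (w x)) with hν
  set ρ : Measure State := ν.map (fun x => addStabilize x State.empty) with hρ
  have key : ∀ h, 0 ≤ h → h ≤ 1 → ρ {η : State | 0 ≤ (η : ℝ) ∧ (η : ℝ) ≤ h} =
      ENNReal.ofReal (p + ∫ x in (0 : ℝ)..h, w x) := by
    intro h h0 h1
    have hS := hmeas (measurableSet_distFun h)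
    have hwh : IntegrableOn w (Set.Ioc 0 h) :=
      ((intervalIntegrable_iff_integrableOn_Ioc_of_le zero_le_one).1 hw).mono_set
        (Set.Ioc_subset_Ioc_right h1)
    have hset : ((fun x : ℝ => addStabilize x State.empty) ⁻¹'
        {η : State | 0 ≤ (η : ℝ) ∧ (η : ℝ) ≤ h} ∩ Set.Ioo 0 1 : Set ℝ) =ᵐ[volume] Set.Ioc 0 h := by
      have hne : ∀ᵐ x : ℝ ∂volume, x ≠ 1 := by simp [ae_iff]
      filter_upwards [hne] with x hx
      apply propext
      change ((0 ≤ ((addStabilize x State.empty : State) : ℝ) ∧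
        ((addStabilize x State.empty : State) : ℝ) ≤ h) ∧ 0 < x ∧ x < 1) ↔ 0 < x ∧ x ≤ h
      constructor
      · rintro ⟨⟨_, h3⟩, h4, h5⟩
        rw [hcoe x h4.le h5] at h3
        exact ⟨h4, h3⟩
      · rintro ⟨h3, h4⟩
        have h5 : x < 1 := lt_of_le_of_ne (h4.trans h1) hx
        rw [hcoe x h3.le h5]
        exact ⟨⟨h3.le, h4⟩, h3, h5⟩
    have hmem : (0 : ℝ) ∈ (fun x : ℝ => addStabilize x State.empty) ⁻¹'
        {η : State | 0 ≤ (η : ℝ) ∧ (η : ℝ) ≤ h} := by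
      change 0 ≤ ((addStabilize 0 State.empty : State) : ℝ) ∧
        ((addStabilize 0 State.empty : State) : ℝ) ≤ h
      rw [hcoe 0 le_rfl zero_lt_one]
      exact ⟨le_rfl, h0⟩
    rw [hρ, Measure.map_apply hmeas (measurableSet_distFun h), hν, Measure.add_apply,
      Measure.smul_apply, Measure.dirac_apply' _ hS, Set.indicator_of_mem hmem,
      withDensity_apply _ hS, Measure.restrict_restrict hS, Measure.restrict_congr_set hset,
      ← ofReal_integral_eq_lintegral_ofReal hwh, intervalIntegral.integral_of_le h0,
      ENNReal.ofReal_add hp]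
    · simp
    · exact setIntegral_nonneg measurableSet_Ioc fun x hx => hw0 x hx.1.le (hx.2.trans h1)
    · filter_upwards [ae_restrict_mem measurableSet_Ioc] with x hx
      exact hw0 x hx.1.le (hx.2.trans h1)
  refine ⟨ρ, ⟨?_⟩, fun h h0 h1 => ?_⟩
  · have huniv : {η : State | 0 ≤ (η : ℝ) ∧ (η : ℝ) ≤ 1} = Set.univ :=
      Set.eq_univ_of_forall fun η => ⟨η.2.1, η.2.2.le⟩
    rw [← huniv, key 1 zero_le_one le_rfl, hp1, ENNReal.ofReal_one]
  · rw [distFun, measureReal_def, key h h0 h1, ENNReal.toReal_ofReal]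
    refine add_nonneg hp (intervalIntegral.integral_nonneg h0 fun x hx => hw0 x hx.1 (hx.2.trans h1))

/-- The stationary distribution has an atom of mass `p = 1 / D (1 / b)` at the empty state and the
density `x ↦ (p / b) * (D (x / b) - D (x / b - 1))`, where `D` is `renewalSum N` for any
`N > 1 / b`. -/
theorem exists_isStationary {b : ℝ} (hb : 0 < b) : ∃ ρ : Measure State, IsStationary 0 b ρ := by
  obtain ⟨N, hN⟩ := exists_nat_gt (1 / b)
  have hT : 0 < 1 / b := by positivity
  set g : ℝ → ℝ := fun x => renewalSum N x - renewalSum N (x - 1)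
  have hgI : ∀ a c, IntervalIntegrable g volume a c := fun a c =>
    (intervalIntegrable_renewalSum N a c).sub (intervalIntegrable_renewalSum_sub_one N a c)
  have hg0 : ∀ x, 0 ≤ x → x ≤ 1 / b → 0 ≤ g x := renewalSum_sub_one_nonneg hN
  have hDT : 1 ≤ renewalSum N (1 / b) := by
    rw [renewalSum_eq_integral hT.le hN]
    have := intervalIntegral.integral_nonneg (μ := volume) hT.le (fun u hu => hg0 u hu.1 hu.2)
    linarith
  set p : ℝ := 1 / renewalSum N (1 / b)
  have hp0 : 0 ≤ p := by positivity
  have hpD : p * renewalSum N (1 / b) = 1 := one_div_mul_cancel (by positivity)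
  have hint : ∀ h, 0 ≤ h → h ≤ 1 →
      p + ∫ x in (0 : ℝ)..h, p / b * g (x / b) = p * renewalSum N (h / b) := by
    intro h h0 h1
    rw [intervalIntegral.integral_const_mul, intervalIntegral.integral_comp_div g hb.ne', zero_div,
      renewalSum_eq_integral (div_nonneg h0 hb.le)
        ((div_le_div_of_nonneg_right h1 hb.le).trans_lt hN), smul_eq_mul, ← mul_assoc,
      div_mul_cancel₀ _ hb.ne']
    ring
  obtain ⟨ρ, hρ, hF⟩ := exists_measure_distFun (w := fun x => p / b * g (x / b)) hp0
    (by
      have := (hgI (0 / b) (1 / b)).comp_mul_left (c := b⁻¹)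
      refine IntervalIntegrable.const_mul ?_ _
      simpa [div_eq_inv_mul, hb.ne'] using this)
    (fun x h0 h1 => mul_nonneg (div_nonneg hp0 hb.le)
      (hg0 _ (div_nonneg h0 hb.le) (div_le_div_of_nonneg_right h1 hb.le)))
    (by rw [hint 1 zero_le_one le_rfl, hpD])
  have hF' : ∀ x, x ≤ 1 / b → distFun ρ (b * x) = p * renewalSum N x := by
    intro x hx
    rcases lt_or_ge x 0 with hx0 | hx0
    · rw [distFun_of_neg ρ (mul_neg_of_pos_of_neg hb hx0), renewalSum_of_neg N hx0, mul_zero]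
    · have hbx0 : 0 ≤ b * x := mul_nonneg hb.le hx0
      have hbx1 : b * x ≤ 1 := by rw [le_div_iff₀ hb] at hx; linarith
      rw [hF _ hbx0 hbx1, hint _ hbx0 hbx1, mul_div_cancel_left₀ _ hb.ne']
  have hA : ∀ x, 0 ≤ x → x ≤ 1 / b →
      ∫ u, distFun ρ (b * x - u) ∂uniformLaw 0 b = p * renewalSum N x - p := by
    intro x hx0 hx1
    rw [integral_uniformLaw hb, renewalSum_eq hx0 (hx1.trans_lt hN), mul_add,
      ← intervalIntegral.integral_const_mul, mul_one, add_sub_cancel_left]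
    refine intervalIntegral.integral_congr fun s hs => ?_
    rw [Set.uIcc_of_le (by linarith)] at hs
    exact hF' s (hs.2.trans hx1)
  have hU := isProbabilityMeasure_uniformLaw hb
  have hprob : IsProbabilityMeasure (ρ.bind (transition 0 b)) := by
    rw [bind_transition hb]
    exact Measure.isProbabilityMeasure_map measurable_addStabilize.aemeasurable
  refine ⟨ρ, hρ, eq_of_distFun_eq fun h h0 h1 => ?_⟩
  have hx0 : 0 ≤ h / b := div_nonneg h0 hb.le
  have hx1 : h / b ≤ 1 / b := div_le_div_of_nonneg_right h1 hb.le
  have hA1 := hA (1 / b) hT.le le_rfl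
  have hAh := hA (h / b) hx0 hx1
  have hFh := hF' (h / b) hx1
  rw [mul_one_div_cancel hb.ne'] at hA1
  rw [mul_div_cancel₀ _ hb.ne'] at hAh hFh
  rw [distFun_bind_transition hb ρ h0 h1, hA1, hAh, hFh, hpD]
  ring

/-! ### The limit of small additions -/

/-- Every affine function `x ↦ p * (2 * x + c)` satisfies the stationary equation with `p` the mass of
the empty state. On `[-1, 0)`, where the distribution function vanishes, it is nonpositive for
`c = 0` and nonnegative for `c = 2`. -/
theorem IsStationary.distFun_bounds {b : ℝ} (hb : 0 < b) {ρ : Measure State}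
    (hρ : IsStationary 0 b ρ) {x : ℝ} (hx0 : 0 ≤ x) (hx1 : x ≤ 1 / b) :
    distFun ρ 0 * (2 * x) ≤ distFun ρ (b * x) ∧
      distFun ρ (b * x) ≤ distFun ρ 0 * (2 * x + 2) := by
  have := hρ.1
  set p := distFun ρ 0
  have hp : 0 < p := hρ.distFun_zero_pos hb
  have hG := intervalIntegrable_distFun hb ρ
  have hlin : ∀ c a d : ℝ, IntervalIntegrable (fun s => p * (2 * s + c)) volume a d := fun c a d =>
    Continuous.intervalIntegrable (by fun_prop) _ _
  have hI : ∀ c t : ℝ, ∫ s in (t - 1)..t, p * (2 * s + c) = p * (2 * t + c) - p := by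
    intro c t
    rw [intervalIntegral.integral_const_mul, intervalIntegral.integral_add
      (Continuous.intervalIntegrable (by fun_prop) _ _)
      (Continuous.intervalIntegrable (by fun_prop) _ _), intervalIntegral.integral_const_mul,
      integral_id, intervalIntegral.integral_const, smul_eq_mul]
    ring
  have h1 := nonneg_of_integral_le (T := 1 / b)
    (f := fun s => distFun ρ (b * s) - p * (2 * s + 0)) (fun a c => (hG a c).sub (hlin 0 a c))
    (fun t _ ht => by
      rw [distFun_of_neg ρ (mul_neg_of_pos_of_neg hb ht)]
      nlinarith)
    (fun t ht0 ht1 => by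
      rw [intervalIntegral.integral_sub (hG _ _) (hlin _ _ _), hI, hρ.distFun_eq hb ht0 ht1]
      linarith) x hx0 hx1
  have h2 := nonneg_of_integral_le (T := 1 / b)
    (f := fun s => p * (2 * s + 2) - distFun ρ (b * s)) (fun a c => (hlin 2 a c).sub (hG a c))
    (fun t ht' ht => by
      rw [distFun_of_neg ρ (mul_neg_of_pos_of_neg hb ht)]
      nlinarith)
    (fun t ht0 ht1 => by
      rw [intervalIntegral.integral_sub (hlin _ _ _) (hG _ _), hI, hρ.distFun_eq hb ht0 ht1]
      linarith) x hx0 hx1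
  constructor <;> linarith

/-- The affine bounds at the threshold, where the distribution function is `1`, confine the slope
`2 p / b` to `[1 / (1 + b), 1]`. -/
theorem IsStationary.abs_distFun_sub_le {b : ℝ} (hb : 0 < b) {ρ : Measure State}
    (hρ : IsStationary 0 b ρ) {h : ℝ} (h0 : 0 ≤ h) (h1 : h ≤ 1) : |distFun ρ h - h| ≤ b := by
  have := hρ.1
  have hx1 : h / b ≤ 1 / b := div_le_div_of_nonneg_right h1 hb.le
  obtain ⟨hl, hu⟩ := hρ.distFun_bounds hb (div_nonneg h0 hb.le) hx1
  obtain ⟨hl1, hu1⟩ := hρ.distFun_bounds hb (x := 1 / b) (by positivity) le_rfl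
  rw [mul_div_cancel₀ _ hb.ne'] at hl hu
  rw [mul_one_div_cancel hb.ne', distFun_of_one_le ρ le_rfl] at hl1 hu1
  -- Twice `q` is the slope, with respect to `h`, of the two affine bounds.
  obtain ⟨q, hq⟩ : ∃ q, distFun ρ 0 = q * b := ⟨distFun ρ 0 / b, by field_simp⟩
  rw [hq] at hl hu hl1 hu1
  have e1 : ∀ y, q * b * (2 * (y / b)) = 2 * q * y := fun y => by field_simp
  have e2 : ∀ y, q * b * (2 * (y / b) + 2) = 2 * q * (y + b) := fun y => by field_simp
  rw [e1] at hl hl1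
  rw [e2] at hu hu1
  rw [abs_le]
  constructor <;> nlinarith

end Zhang

theorem mainTheorem3 :
    -- part (a), with the existence and uniqueness of the stationary distribution
    (∀ b : ℝ, 0 < b → b ≤ 1 →
      (∃! ρ : Measure Zhang.State, Zhang.IsStationary 0 b ρ) ∧
      ∀ ρ : Measure Zhang.State, Zhang.IsStationary 0 b ρ →
        (∀ h : ℝ, h < 0 → Zhang.distFun ρ h = 0) ∧
        0 < Zhang.distFun ρ 0 ∧
        (∀ h : ℝ, 0 < h → h ≤ 1 →
          Zhang.distFun ρ h = Zhang.distFun ρ 0 * Zhang.delaySum b h) ∧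
        (∀ h : ℝ, 1 < h → Zhang.distFun ρ h = 1) ∧
        Zhang.distFun ρ 1 = 1 ∧
        Zhang.distFun ρ 0 = 1 / Zhang.delaySum b 1) ∧
    -- part (b)
    (∀ ρ : ℝ → Measure Zhang.State,
      (∀ b : ℝ, 0 < b → b ≤ 1 → Zhang.IsStationary 0 b (ρ b)) →
      ∀ h : ℝ, 0 ≤ h → h ≤ 1 →
        Tendsto (fun b : ℝ => Zhang.distFun (ρ b) h) (𝓝[>] (0 : ℝ)) (𝓝 h)) := by
  refine ⟨fun b hb _ => ⟨?_, fun ρ hρ => ?_⟩, fun ρ hρ h h0 h1 => ?_⟩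
  · obtain ⟨ρ, hρ⟩ := Zhang.exists_isStationary hb
    exact ⟨ρ, hρ, fun ρ' hρ' => hρ'.unique hb hρ⟩
  · have := hρ.1
    obtain ⟨N, hN⟩ := exists_nat_gt (1 / b)
    refine ⟨fun h hh => Zhang.distFun_of_neg ρ hh, hρ.distFun_zero_pos hb, fun h h0 h1 => ?_,
      fun h hh => Zhang.distFun_of_one_le ρ hh.le, Zhang.distFun_of_one_le ρ le_rfl, ?_⟩
    · have hx1 : h / b ≤ 1 / b := div_le_div_of_nonneg_right h1 hb.le
      rw [Zhang.delaySum_eq_renewalSum hb h0 (hx1.trans_lt hN),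
        ← hρ.distFun_eq_renewalSum hb hN (div_nonneg h0.le hb.le) hx1, mul_div_cancel₀ _ hb.ne']
    · rw [Zhang.delaySum_eq_renewalSum hb one_pos hN]
      exact eq_one_div_of_mul_eq_one_left (hρ.distFun_zero_mul hb hN)
  · rw [tendsto_iff_dist_tendsto_zero]
    refine squeeze_zero' (Eventually.of_forall fun _ => dist_nonneg) ?_
      (tendsto_nhdsWithin_of_tendsto_nhds tendsto_id)
    filter_upwards [Ioc_mem_nhdsGT one_pos] with b hb
    exact (hρ b hb.1 hb.2).abs_distFun_sub_le hb.1 h0 h1
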